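/- For a real number $x$ let $\|x\|$ denote the distance from $x$ to the nearest integer. For $\Theta=(\theta^1,\theta^2,\theta^3)\in\mathbb{R}^3$ (one linear form in three variables, $m=3$, $n=1$) and $t\ge 1$ put $$\psi_\Theta(t)=\min_{\mathbf{x}\in\mathbb{Z}^3:\ 0<\max_i|x_i|\le t}\ \|\theta^1x_1+\theta^2x_2+\theta^3x_3\|,$$ and define the uniform and the individual Diophantine exponents $$\alpha(\Theta)=\sup\{\gamma>0:\ \limsup_{t\to+\infty}t^\gamma\psi_\Theta(t)<+\infty\},\qquad \beta(\Theta)=\sup\{\gamma>0:\ \liminf_{t\to+\infty}t^\gamma\psi_\Theta(t)<+\infty\},$$ the suprema being taken in $[-\infty,+\infty]$. For $\alpha\ge 3$ put $$g_2(\alpha)=\sqrt{\alpha+\frac1{\alpha^2}-\frac74}+\frac1\alpha-\frac12 .$$ Theorem 3. Suppose that $1,\theta^1,\theta^2,\theta^3$ are linearly independent over $\mathbb{Z}$. Then $\alpha(\Theta)\ge 3$ (so that $g_2(\alpha(\Theta))$ is defined when $\alpha(\Theta)$ is finite), and $$\beta(\Theta)\ \ge\ \alpha(\Theta)\,g_2(\alpha(\Theta)),$$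 where for $\alpha(\Theta)=+\infty$ the right-hand side is understood as $+\infty$, so that $\beta(\Theta)=+\infty$. Moreover, this bound is better than Jarník's bound $\beta(\Theta)\ge\alpha(\Theta)^{3/2}-3\alpha(\Theta)$ for all values of $\alpha(\Theta)$: for every real $\alpha\ge 3$, $$\alpha\,g_2(\alpha)>\alpha^{3/2}-3\alpha .$$ -/

import Mathlib

open Filter

noncomputable section

namespace Diophantine

/-- Distance `||x||` from a real number to the nearest integer. -/
def distInt (x : ℝ) : ℝ := |x - round x|

/-- The `j`-th linear form `L_j(x) = ∑ i, θ_j^i x_i` of the `n × m` matrix `Θ`. -/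
def linForm {n m : ℕ} (Θ : Matrix (Fin n) (Fin m) ℝ) (j : Fin n) (x : Fin m → ℤ) : ℝ :=
  ∑ i, Θ j i * (x i : ℝ)

/-- `ζ(x) = max_j ||L_j(x)||`. -/
def zeta {n m : ℕ} (Θ : Matrix (Fin n) (Fin m) ℝ) (x : Fin m → ℤ) : ℝ :=
  ⨆ j, distInt (linForm Θ j x)

/-- `ψ_Θ(t) = min { max_j ||L_j(x)|| : x ∈ ℤ^m, 0 < max_i |x_i| ≤ t }`.
Here `‖x‖` is the maximum norm on `Fin m → ℤ`. For `t ≥ 1` (and `m ≥ 1`) the set is finite and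
nonempty, so the infimum is a minimum; only large `t` matter below. -/
def psi {n m : ℕ} (Θ : Matrix (Fin n) (Fin m) ℝ) (t : ℝ) : ℝ :=
  sInf (zeta Θ '' {x : Fin m → ℤ | 0 < ‖x‖ ∧ ‖x‖ ≤ t})

/-- The uniform exponent `α(Θ)`, a supremum in the extended reals (`⊤` is allowed). The `limsup`
is taken in the extended reals too. -/
def uniformExponent {n m : ℕ} (Θ : Matrix (Fin n) (Fin m) ℝ) : EReal :=
  sSup {e : EReal | ∃ γ : ℝ, 0 < γ ∧ e = (γ : EReal) ∧
    limsup (fun t : ℝ => ((t ^ γ * psi Θ t : ℝ) : EReal)) atTop < ⊤}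

/-- The individual exponent `β(Θ)`, a supremum in the extended reals (`⊤` is allowed). -/
def individualExponent {n m : ℕ} (Θ : Matrix (Fin n) (Fin m) ℝ) : EReal :=
  sSup {e : EReal | ∃ γ : ℝ, 0 < γ ∧ e = (γ : EReal) ∧
    liminf (fun t : ℝ => ((t ^ γ * psi Θ t : ℝ) : EReal)) atTop < ⊤}

/-- `g₂(α) = √(α + 1/α² - 7/4) + 1/α - 1/2`, used for `α ≥ 3`. -/
def g2 (a : ℝ) : ℝ := Real.sqrt (a + 1 / a ^ 2 - 7 / 4) + 1 / a - 1 / 2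

end Diophantine

end

/-!
Let `zₙ` be the best approximations of the form `L = y + ∑ θⁱ xᵢ`, with heights `Xₙ`. The lattice
`⟨zₙ, zₙ₊₁⟩` has covolume comparable to `|L zₙ| Xₙ₊₁`. This tends to zero, so these lattices do
not eventually all lie in the same plane. If the `zₙ` do not stay in a proper subspace, there are
arbitrarily large `i < k` such that `zᵢ, zᵢ₊₁, zᵢ₊₂, zₖ₊₂` are independent while `⟨zᵢ₊₁, zᵢ₊₂⟩`
and `⟨zₖ, zₖ₊₁⟩` span the same plane. The nonzero integer determinant gives
`1 ≪ |L zᵢ| Xᵢ₊₁ Xᵢ₊₂ Xₖ₊₂`, and comparing covolumes gives `|L zᵢ₊₁| Xᵢ₊₂ ≪ |L zₖ| Xₖ₊₁`. For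
`γ < α(Θ)` and `b > β(Θ)` we have `|L zₙ| ≪ Xₙ₊₁ ^ (-γ)` and `|L zₙ| ≫ Xₙ ^ (-b)`, and eliminating
the heights yields `γ² (γ - 1) ≤ γ b + b²`, that is, `b / γ` is at least the positive root `g` of
`g² + g = γ - 1`; for `γ ≥ 3` this root is at least `g2 γ`. If the `zₙ` do stay in a proper
subspace, the fourth row of the determinant can be taken bounded, which gives the stronger
inequality `γ (γ - 1) ≤ b`.
-/

namespace Diophantine

section Determinants

variable {n : Type*} [Fintype n] [DecidableEq n]

lemma abs_det_le_of_abs_le_mul {A : Matrix n n ℝ} {u v : n → ℝ}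
    (h : ∀ i j, |A i j| ≤ u i * v j) :
    |A.det| ≤ (Fintype.card n).factorial * ((∏ i, u i) * ∏ j, v j) := by
  have hterm (σ : Equiv.Perm n) :
      |Equiv.Perm.sign σ • ∏ j, A (σ j) j| ≤ (∏ i, u i) * ∏ j, v j :=
    calc |Equiv.Perm.sign σ • ∏ j, A (σ j) j| = ∏ j, |A (σ j) j| := by
          rcases Int.units_eq_one_or (Equiv.Perm.sign σ) with hσ | hσ <;>
            simp [hσ, Finset.abs_prod]
      _ ≤ ∏ j, u (σ j) * v j :=
          Finset.prod_le_prod (fun _ _ => abs_nonneg _) fun j _ => h (σ j) j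
      _ = (∏ i, u i) * ∏ j, v j := by rw [Finset.prod_mul_distrib, Equiv.prod_comp σ u]
  rw [Matrix.det_apply, ← Fintype.card_perm, ← nsmul_eq_mul]
  exact (Finset.abs_sum_le_sum_abs _ _).trans (Finset.sum_le_card_nsmul _ _ _ fun σ _ => hterm σ)

/-- The vectors with integer coordinates, as a lattice in the real coordinate space. -/
def integerVectors (n : Type*) : AddSubgroup (n → ℝ) :=
  ((Int.castAddHom ℝ).compLeft n).range

lemma one_le_abs_det {A : Matrix n n ℝ} (hA : ∀ i, A i ∈ integerVectors n)
    (h : LinearIndependent ℝ A.row) : 1 ≤ |A.det| := by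
  choose Z hZ using hA
  obtain rfl : (Matrix.of Z).map (Int.cast : ℤ → ℝ) = A := by
    ext i j; exact congrFun (hZ i) j
  have hdet := ((Matrix.isUnit_iff_isUnit_det _).1
    (Matrix.linearIndependent_rows_iff_isUnit.1 h)).ne_zero
  rw [← Int.cast_det] at hdet ⊢
  exact_mod_cast Int.one_le_abs (Int.cast_ne_zero.1 hdet)

lemma det_eq_zero_of_forall_mem {S : Submodule ℝ (n → ℝ)} (hS : S ≠ ⊤) {A : Matrix n n ℝ}
    (hA : ∀ i, A i ∈ S) : A.det = 0 := by
  refine Matrix.detRowAlternating.map_linearDependent A fun hli => hS (top_le_iff.1 ?_)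
  rw [← hli.span_eq_top_of_card_eq_finrank' (by simp)]
  exact Submodule.span_le.2 (Set.range_subset_iff.2 hA)

lemma det_cons_eq_of_sub_mem {m : ℕ} {S : Submodule ℝ (Fin (m + 1) → ℝ)} (hS : S ≠ ⊤)
    {v : Fin m → Fin (m + 1) → ℝ} (hv : ∀ i, v i ∈ S) {x y : Fin (m + 1) → ℝ} (hxy : x - y ∈ S) :
    (Matrix.of (Matrix.vecCons x v)).det = (Matrix.of (Matrix.vecCons y v)).det := by
  have hzero : (Matrix.of (Matrix.vecCons (x - y) v)).det = 0 :=
    det_eq_zero_of_forall_mem hS (Fin.cases hxy hv)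
  have hadd : (Matrix.of (Matrix.vecCons (x - y + y) v)).det =
      (Matrix.of (Matrix.vecCons (x - y) v)).det + (Matrix.of (Matrix.vecCons y v)).det :=
    Matrix.detRowAlternating.toMultilinearMap.cons_add v (x - y) y
  rwa [sub_add_cancel, hzero, zero_add] at hadd

end Determinants

section BestApproximations

variable {E : Type*} [AddCommGroup E] [Module ℝ E] {L : E →ₗ[ℝ] ℝ} {p : Seminorm ℝ E}
  {Λ : AddSubgroup E}

/-- A minimal point of the lattice `Λ` for the linear form `L`: no nonzero lattice point that is at
most as large, with respect to `p`, gives `L` a smaller absolute value. -/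
structure IsMinimalPoint (L : E →ₗ[ℝ] ℝ) (p : Seminorm ℝ E) (Λ : AddSubgroup E) (x : E) :
    Prop where
  mem : x ∈ Λ
  ne_zero : x ≠ 0
  abs_le : ∀ w ∈ Λ, w ≠ 0 → p w ≤ p x → |L x| ≤ |L w|

/-- A sequence of best approximations to zero by the linear form `L` on the lattice `Λ`, the size
of a lattice point being measured by `p`. -/
structure IsBestApproxSeq (L : E →ₗ[ℝ] ℝ) (p : Seminorm ℝ E) (Λ : AddSubgroup E) (z : ℕ → E) :
    Prop where
  mem : ∀ n, z n ∈ Λ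
  size_pos : ∀ n, 0 < p (z n)
  size_lt : ∀ n, p (z n) < p (z (n + 1))
  abs_lt : ∀ n, |L (z (n + 1))| < |L (z n)|
  abs_le : ∀ n, ∀ w ∈ Λ, w ≠ 0 → p w < p (z (n + 1)) → |L (z n)| ≤ |L w|

lemma exists_isMinimalPoint_abs_lt
    (hfin : ∀ M K, {x ∈ (Λ : Set E) | p x ≤ M ∧ |L x| ≤ K}.Finite)
    {K : ℝ} (hK : ∃ x ∈ Λ, x ≠ 0 ∧ |L x| < K) :
    ∃ x, IsMinimalPoint L p Λ x ∧ |L x| < K ∧ ∀ w ∈ Λ, w ≠ 0 → p w < p x → K ≤ |L w| := by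
  obtain ⟨x₀, hx₀, hx₀0, hx₀K⟩ := hK
  obtain ⟨x, ⟨hx, hx0, hxK, hxx₀⟩, hmin⟩ :=
    Set.exists_min_image {x | x ∈ Λ ∧ x ≠ 0 ∧ |L x| < K ∧ p x ≤ p x₀}
      (fun x => toLex (p x, |L x|))
      ((hfin (p x₀) K).subset fun x hx => ⟨hx.1, hx.2.2.2, hx.2.2.1.le⟩)
      ⟨x₀, hx₀, hx₀0, hx₀K, le_rfl⟩
  have hlex : ∀ w ∈ Λ, w ≠ 0 → |L w| < K → p w ≤ p x → p x = p w ∧ |L x| ≤ |L w| := by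
    intro w hw hw0 hwK hwx
    rcases Prod.Lex.toLex_le_toLex.1 (hmin w ⟨hw, hw0, hwK, hwx.trans hxx₀⟩) with h | h
    · exact absurd h hwx.not_gt
    · exact h
  refine ⟨x, ⟨hx, hx0, fun w hw hw0 hwx => ?_⟩, hxK, fun w hw hw0 hwx => ?_⟩
  · rcases lt_or_ge |L w| K with hwK | hwK
    · exact (hlex w hw hw0 hwK hwx).2
    · exact hxK.le.trans hwK
  · by_contra! hwK
    exact hwx.ne' (hlex w hw hw0 hwK hwx.le).1

lemma exists_isBestApproxSeq
    (hfin : ∀ M K, {x ∈ (Λ : Set E) | p x ≤ M ∧ |L x| ≤ K}.Finite)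
    (hsmall : ∀ K > 0, ∃ x ∈ Λ, x ≠ 0 ∧ |L x| < K) (hL : ∀ x ∈ Λ, x ≠ 0 → L x ≠ 0) :
    ∃ z, IsBestApproxSeq L p Λ z := by
  have hnext (x : {x // IsMinimalPoint L p Λ x}) : ∃ y : {x // IsMinimalPoint L p Λ x},
      |L y| < |L x| ∧ ∀ w ∈ Λ, w ≠ 0 → p w < p y → |L x| ≤ |L w| := by
    obtain ⟨y, hy, hyx, hle⟩ := exists_isMinimalPoint_abs_lt hfin
      (hsmall _ (abs_pos.2 (hL x x.2.mem x.2.ne_zero)))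
    exact ⟨⟨y, hy⟩, hyx, hle⟩
  choose next hlt hle using hnext
  have hsize (x : {x // IsMinimalPoint L p Λ x}) : p x < p (next x) := by
    by_contra! h
    exact (x.2.abs_le _ (next x).2.mem (next x).2.ne_zero h).not_gt (hlt x)
  obtain ⟨x₀, hx₀, -⟩ := exists_isMinimalPoint_abs_lt hfin (hsmall 1 one_pos)
  let s (n : ℕ) := next^[n] ⟨x₀, hx₀⟩
  have hs (n : ℕ) : s (n + 1) = next (s n) := Function.iterate_succ_apply' next n _
  refine ⟨fun n => s (n + 1), fun n => (s (n + 1)).2.mem, fun n => ?_, fun n => ?_, fun n => ?_,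
    fun n => ?_⟩
  · simpa only [hs] using (apply_nonneg p _).trans_lt (hsize (s n))
  · simpa only [hs] using hsize (next (s n))
  · simpa only [hs] using hlt (next (s n))
  · simpa only [hs] using hle (next (s n))

/-- The combination of `a` and `b` on which `L` vanishes; up to sign it depends only on the
bivector `a ∧ b`. -/
def wedge (L : E →ₗ[ℝ] ℝ) (a b : E) : E := L a • b - L b • a

lemma wedge_combination (a b : E) (s t u v : ℝ) :
    wedge L (s • a + t • b) (u • a + v • b) = (s * v - t * u) • wedge L a b := by
  simp only [wedge, map_add, map_smul, smul_eq_mul]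
  module

/-- The plane spanned by two consecutive vectors of a sequence. -/
def plane (z : ℕ → E) (n : ℕ) : Submodule ℝ E := Submodule.span ℝ {z n, z (n + 1)}

variable {z : ℕ → E} {n m : ℕ}

lemma mem_plane_left (z : ℕ → E) (n : ℕ) : z n ∈ plane z n :=
  Submodule.subset_span (by simp)

lemma mem_plane_right (z : ℕ → E) (n : ℕ) : z (n + 1) ∈ plane z n :=
  Submodule.subset_span (by simp)

lemma plane_eq_span_range (z : ℕ → E) (n : ℕ) :
    plane z n = Submodule.span ℝ (Set.range ![z n, z (n + 1)]) := by
  rw [plane, Matrix.range_cons_cons_empty]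

lemma exists_abs_sub_mul_eq {s t : ℝ} (h : |t| ≤ |s|) :
    ∃ e : ℤ, |e| = 1 ∧ |t - e * s| = |s| - |t| := by
  rcases le_total 0 s with hs | hs <;> rcases le_total 0 t with ht | ht
  · exact ⟨1, rfl, by grind⟩
  · exact ⟨-1, rfl, by grind⟩
  · exact ⟨-1, rfl, by grind⟩
  · exact ⟨1, rfl, by grind⟩

namespace IsBestApproxSeq

lemma strictMono_size (h : IsBestApproxSeq L p Λ z) : StrictMono fun n => p (z n) :=
  strictMono_nat_of_lt_succ h.size_lt

lemma strictAnti_abs (h : IsBestApproxSeq L p Λ z) : StrictAnti fun n => |L (z n)| :=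
  strictAnti_nat_of_succ_lt h.abs_lt

lemma abs_pos (h : IsBestApproxSeq L p Λ z) (n : ℕ) : 0 < |L (z n)| :=
  (abs_nonneg _).trans_lt (h.abs_lt n)

lemma tendsto_size (h : IsBestApproxSeq L p Λ z)
    (hfin : ∀ M K, {x ∈ (Λ : Set E) | p x ≤ M ∧ |L x| ≤ K}.Finite) :
    Tendsto (fun n => p (z n)) atTop atTop := by
  refine tendsto_atTop_atTop_of_monotone h.strictMono_size.monotone fun M => ?_
  by_contra! hbdd
  refine Set.infinite_range_of_injective (f := z) ?_ ((hfin M |L (z 0)|).subset ?_)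
  · exact Function.Injective.of_comp (f := p) h.strictMono_size.injective
  · rintro _ ⟨n, rfl⟩
    exact ⟨h.mem n, (hbdd n).le, h.strictAnti_abs.antitone (Nat.zero_le n)⟩

lemma size_le_of_abs_lt (h : IsBestApproxSeq L p Λ z) {w : E} (hw : w ∈ Λ) (hw0 : w ≠ 0)
    (hlt : |L w| < |L (z n)|) : p (z (n + 1)) ≤ p w := by
  by_contra! hsize
  exact (h.abs_le n w hw hw0 hsize).not_gt hlt

lemma abs_mul_size_le_wedge (h : IsBestApproxSeq L p Λ z) (n : ℕ) :
    |L (z n)| * p (z (n + 1)) ≤ 2 * p (wedge L (z n) (z (n + 1))) := by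
  set a := z n
  set b := z (n + 1)
  have hba : |L b| < |L a| := h.abs_lt n
  have hab : p a < p b := h.size_lt n
  obtain ⟨e, he, heq⟩ := exists_abs_sub_mul_eq hba.le
  have heL : L (b - e • a) = L b - e * L a := by simp
  have hbe : p b ≤ p (b - e • a) := by
    refine h.size_le_of_abs_lt (sub_mem (h.mem _) (zsmul_mem (h.mem n) e)) (fun h0 => ?_) ?_
    · have hpb : p b = p a := by
        rw [sub_eq_zero.1 h0, ← Int.cast_smul_eq_zsmul ℝ, map_smul_eq_mul, Real.norm_eq_abs,
          ← Int.cast_abs, he, Int.cast_one, one_mul]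
      exact hab.ne' hpb
    · rw [heL, heq]
      exact sub_lt_self _ (h.abs_pos (n + 1))
  have hb : |L a| * p b ≤ p (wedge L a b) + |L b| * p a := by
    have hdecomp : L a • b = wedge L a b + L b • a := (sub_add_cancel _ _).symm
    rw [← Real.norm_eq_abs, ← Real.norm_eq_abs (L b), ← map_smul_eq_mul, ← map_smul_eq_mul,
      hdecomp]
    exact map_add_le_add p _ _
  have hbea : |L a| * p (b - e • a) ≤ p (wedge L a b) + (|L a| - |L b|) * p a := by
    have hdecomp : L a • (b - e • a) = wedge L a b + (L b - e * L a) • a := by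
      rw [wedge, ← Int.cast_smul_eq_zsmul ℝ]
      module
    rw [← heq, ← Real.norm_eq_abs, ← Real.norm_eq_abs (L b - _), ← map_smul_eq_mul,
      ← map_smul_eq_mul, hdecomp]
    exact map_add_le_add p _ _
  nlinarith [mul_le_mul_of_nonneg_left hbe (abs_nonneg (L a)),
    mul_le_mul_of_nonneg_left hab.le (abs_nonneg (L a))]

lemma wedge_le_abs_mul_size (h : IsBestApproxSeq L p Λ z) (n : ℕ) :
    p (wedge L (z n) (z (n + 1))) ≤ 2 * (|L (z n)| * p (z (n + 1))) :=
  calc p (wedge L (z n) (z (n + 1)))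
      ≤ |L (z n)| * p (z (n + 1)) + |L (z (n + 1))| * p (z n) := by
        simpa only [wedge, map_smul_eq_mul, Real.norm_eq_abs] using
          map_sub_le_add p (L (z n) • z (n + 1)) (L (z (n + 1)) • z n)
    _ ≤ |L (z n)| * p (z (n + 1)) + |L (z n)| * p (z (n + 1)) :=
        add_le_add_right (mul_le_mul (h.abs_lt n).le (h.size_lt n).le (apply_nonneg p _)
          (abs_nonneg _)) _
    _ = 2 * (|L (z n)| * p (z (n + 1))) := (two_mul _).symm

lemma abs_mul_size_pos (h : IsBestApproxSeq L p Λ z) (n : ℕ) : 0 < |L (z n)| * p (z (n + 1)) :=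
  mul_pos (h.abs_pos n) (h.size_pos (n + 1))

lemma wedge_pos (h : IsBestApproxSeq L p Λ z) (n : ℕ) :
    0 < p (wedge L (z n) (z (n + 1))) := by
  linarith [h.abs_mul_size_le_wedge n, h.abs_mul_size_pos n]

lemma exists_int_combination (h : IsBestApproxSeq L p Λ z) {w : E} (hw : w ∈ Λ)
    (hwn : w ∈ plane z n) : ∃ s t : ℤ, w = (s : ℝ) • z n + (t : ℝ) • z (n + 1) := by
  obtain ⟨s, t, rfl⟩ := Submodule.mem_span_pair.1 hwn
  refine ⟨round s, round t, ?_⟩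
  by_contra hne
  set r : E := s • z n + t • z (n + 1) - (round s • z n + round t • z (n + 1)) with hr_def
  have hr : r = (s - round s) • z n + (t - round t) • z (n + 1) := by
    simp only [hr_def, ← Int.cast_smul_eq_zsmul ℝ]
    module
  have hr0 : r ≠ 0 := by
    simpa only [hr_def, ne_eq, sub_eq_zero, ← Int.cast_smul_eq_zsmul ℝ] using hne
  have hrΛ : r ∈ Λ :=
    sub_mem hw (add_mem (zsmul_mem (h.mem _) _) (zsmul_mem (h.mem _) _))
  have hs := abs_sub_round s
  have ht := abs_sub_round t
  have habs : |L r| < |L (z n)| :=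
    calc |L r| ≤ |s - round s| * |L (z n)| + |t - round t| * |L (z (n + 1))| := by
          simpa only [hr, map_add, map_smul, smul_eq_mul, abs_mul] using
            abs_add_le ((s - round s) * L (z n)) ((t - round t) * L (z (n + 1)))
      _ ≤ 1 / 2 * |L (z n)| + 1 / 2 * |L (z (n + 1))| := by gcongr
      _ < |L (z n)| := by linarith [h.abs_lt n]
  have hsize : p r < p (z (n + 1)) :=
    calc p r ≤ |s - round s| * p (z n) + |t - round t| * p (z (n + 1)) := by
          simpa only [hr, map_smul_eq_mul, Real.norm_eq_abs] using
            map_add_le_add p ((s - round s) • z n) ((t - round t) • z (n + 1))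
      _ ≤ 1 / 2 * p (z n) + 1 / 2 * p (z (n + 1)) := by gcongr
      _ < p (z (n + 1)) := by linarith [h.size_lt n]
  exact (h.size_le_of_abs_lt hrΛ hr0 habs).not_gt hsize

/-- Consecutive best approximations in a plane form a basis of its lattice points, so up to
constants `|L (z n)| * p (z (n + 1))` is the covolume of that planar lattice. -/
lemma abs_mul_size_le_of_mem_plane (h : IsBestApproxSeq L p Λ z) (hm : z m ∈ plane z n)
    (hm' : z (m + 1) ∈ plane z n) :
    |L (z n)| * p (z (n + 1)) ≤ 4 * (|L (z m)| * p (z (m + 1))) := by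
  obtain ⟨s, t, hst⟩ := h.exists_int_combination (h.mem m) hm
  obtain ⟨u, v, huv⟩ := h.exists_int_combination (h.mem (m + 1)) hm'
  have hdet : p (wedge L (z m) (z (m + 1))) =
      |((s * v - t * u : ℤ) : ℝ)| * p (wedge L (z n) (z (n + 1))) := by
    rw [hst, huv, wedge_combination, map_smul_eq_mul, Real.norm_eq_abs]
    push_cast
    rfl
  have hdet0 : s * v - t * u ≠ 0 := by
    intro h0
    have := h.wedge_pos m
    simp [hdet, h0] at this
  have hdet1 : (1 : ℝ) ≤ |((s * v - t * u : ℤ) : ℝ)| := by exact_mod_cast Int.one_le_abs hdet0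
  calc |L (z n)| * p (z (n + 1)) ≤ 2 * p (wedge L (z n) (z (n + 1))) := h.abs_mul_size_le_wedge n
    _ ≤ 2 * p (wedge L (z m) (z (m + 1))) := by
        rw [hdet]
        gcongr
        exact le_mul_of_one_le_left (apply_nonneg p _) hdet1
    _ ≤ 2 * (2 * (|L (z m)| * p (z (m + 1)))) := by
        gcongr
        exact h.wedge_le_abs_mul_size m
    _ = 4 * (|L (z m)| * p (z (m + 1))) := by ring

lemma linearIndependent_pair (h : IsBestApproxSeq L p Λ z) (n : ℕ) :
    LinearIndependent ℝ ![z n, z (n + 1)] := by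
  have hn0 : z n ≠ 0 := fun h0 => (h.size_pos n).ne' (by rw [h0, map_zero])
  refine (LinearIndependent.pair_iff' hn0).2 fun c hc => (h.wedge_pos n).ne' ?_
  rw [← hc, wedge, map_smul, smul_eq_mul, smul_smul, mul_comm, sub_self, map_zero]

lemma plane_eq_of_mem (h : IsBestApproxSeq L p Λ z) (hm : z m ∈ plane z n)
    (hm' : z (m + 1) ∈ plane z n) : plane z m = plane z n := by
  have hrank (k : ℕ) : Module.finrank ℝ (plane z k) = 2 := by
    rw [plane_eq_span_range, finrank_span_eq_card (h.linearIndependent_pair k), Fintype.card_fin]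
  have : FiniteDimensional ℝ (plane z n) := FiniteDimensional.span_of_finite ℝ (Set.toFinite _)
  exact Submodule.eq_of_le_of_finrank_eq (Submodule.span_le.2 (Set.pair_subset hm hm'))
    ((hrank m).trans (hrank n).symm)

lemma linearIndependent_triple (h : IsBestApproxSeq L p Λ z) {w : E} (hw : w ∉ plane z n) :
    LinearIndependent ℝ ![w, z n, z (n + 1)] :=
  linearIndependent_finCons.2 ⟨h.linearIndependent_pair n, by rwa [← plane_eq_span_range]⟩

lemma frequently_notMem_plane (h : IsBestApproxSeq L p Λ z)
    (h0 : Tendsto (fun n => |L (z n)| * p (z (n + 1))) atTop (nhds 0)) :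
    ∃ᶠ i in atTop, z (i + 2) ∉ plane z i := by
  intro hev
  obtain ⟨n, hn⟩ := eventually_atTop.1 hev
  have hconst : ∀ m ≥ n, plane z m = plane z n := by
    refine Nat.le_induction rfl fun m hm ih => ?_
    rw [← ih]
    exact h.plane_eq_of_mem (mem_plane_right z m) (not_not.1 (hn m hm))
  have hle : ∀ᶠ m in atTop,
      |L (z n)| * p (z (n + 1)) ≤ 4 * (|L (z m)| * p (z (m + 1))) := by
    filter_upwards [eventually_ge_atTop n] with m hm
    exact h.abs_mul_size_le_of_mem_plane (hconst m hm ▸ mem_plane_left z m)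
      (hconst m hm ▸ mem_plane_right z m)
  exact (ge_of_tendsto (h0.const_mul 4) hle).not_gt (by simpa using h.abs_mul_size_pos n)

lemma exists_last_notMem_plane (h : IsBestApproxSeq L p Λ z) {j k : ℕ}
    (hj : z (j + 2) ∉ plane z j) (hjk : j + 1 ≤ k) :
    ∃ i, j ≤ i ∧ i < k ∧ z (i + 2) ∉ plane z i ∧ plane z (i + 1) = plane z k := by
  induction k, hjk using Nat.le_induction with
  | base => exact ⟨j, le_rfl, j.lt_succ_self, hj, rfl⟩
  | succ k hjk ih =>
    by_cases hk : z (k + 2) ∈ plane z k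
    · obtain ⟨i, hji, hik, hi, hplane⟩ := ih
      exact ⟨i, hji, hik.trans k.lt_succ_self, hi,
        hplane.trans (h.plane_eq_of_mem (mem_plane_right z k) hk).symm⟩
    · exact ⟨k, by omega, k.lt_succ_self, hk, rfl⟩

lemma frequently_linearIndependent_quadruple (h : IsBestApproxSeq L p Λ z)
    (hE : 3 < Module.finrank ℝ E)
    (h0 : Tendsto (fun n => |L (z n)| * p (z (n + 1))) atTop (nhds 0))
    (hspan : ∀ S : Submodule ℝ E, S ≠ ⊤ → ∃ᶠ n in atTop, z n ∉ S) :
    ∃ᶠ i in atTop, ∃ k > i, plane z (i + 1) = plane z k ∧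
      LinearIndependent ℝ ![z (k + 2), z (i + 2), z i, z (i + 1)] := by
  classical
  refine frequently_atTop.2 fun N => ?_
  obtain ⟨j, hNj, hj⟩ := frequently_atTop.1 (h.frequently_notMem_plane h0) N
  set S : Submodule ℝ E := Submodule.span ℝ (Set.range ![z j, z (j + 1), z (j + 2)])
  have hS : S ≠ ⊤ := by
    intro hS
    have hcard := finrank_range_le_card (R := ℝ) ![z j, z (j + 1), z (j + 2)]
    rw [Set.finrank, show Submodule.span ℝ _ = ⊤ from hS, finrank_top, Fintype.card_fin] at hcard
    exact hE.not_ge hcard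
  have hexit : ∃ k, j ≤ k ∧ z (k + 2) ∉ S := by
    obtain ⟨l, hl, hlS⟩ := frequently_atTop.1 (hspan S hS) (j + 2)
    exact ⟨l - 2, by omega, by rwa [Nat.sub_add_cancel (by omega)]⟩
  obtain ⟨hjk, hk⟩ := Nat.find_spec hexit
  set k := Nat.find hexit with hk_def
  have hmem (l : ℕ) (hjl : j ≤ l) (hlk : l < k + 2) : z l ∈ S := by
    obtain rfl | rfl | hl : l = j ∨ l = j + 1 ∨ j + 2 ≤ l := by omega
    · exact Submodule.subset_span ⟨0, rfl⟩
    · exact Submodule.subset_span ⟨1, rfl⟩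
    · have := Nat.find_min hexit (m := l - 2) (by omega)
      grind
  have hjk' : j + 1 ≤ k := by
    refine hjk.lt_of_ne fun heq => hk ?_
    rw [← heq]
    exact Submodule.subset_span ⟨2, rfl⟩
  obtain ⟨i, hji, hik, hi, hplane⟩ := h.exists_last_notMem_plane hj hjk'
  refine ⟨i, hNj.trans hji, k, hik, hplane, linearIndependent_finCons.2
    ⟨h.linearIndependent_triple hi, fun hcon => hk (Submodule.span_le.2 ?_ hcon)⟩⟩
  rintro _ ⟨r, rfl⟩
  fin_cases r
  exacts [hmem (i + 2) (by omega) (by omega), hmem i hji (by omega),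
    hmem (i + 1) (by omega) (by omega)]

end IsBestApproxSeq

end BestApproximations

section IntegerVectors

variable {m : ℕ} {θ : Fin m → ℝ}

/-- The seminorm `max (|x₁|, …, |xₘ|)` of the vector `(y, x₁, …, xₘ)`: the coordinate `y`, which
plays the role of the nearest integer to `θ₁ x₁ + … + θₘ xₘ`, is ignored. -/
noncomputable def height : Seminorm ℝ (Fin (m + 1) → ℝ) :=
  (normSeminorm ℝ (Fin m → ℝ)).comp (LinearMap.funLeft ℝ ℝ Fin.succ)

/-- The homogeneous linear form `y + θ₁ x₁ + … + θₘ xₘ` of the vector `(y, x₁, …, xₘ)`. -/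
noncomputable def form (θ : Fin m → ℝ) : (Fin (m + 1) → ℝ) →ₗ[ℝ] ℝ :=
  Fintype.linearCombination ℝ (Fin.cons 1 θ)

lemma form_apply (θ : Fin m → ℝ) (a : Fin (m + 1) → ℝ) :
    form θ a = a 0 + ∑ i, θ i * a i.succ := by
  simp [form, Fintype.linearCombination_apply, Fin.sum_univ_succ, mul_comm]

lemma form_cons (θ : Fin m → ℝ) (y : ℝ) (x : Fin m → ℝ) :
    form θ (Fin.cons y x) = y + ∑ i, θ i * x i := by
  simp [form_apply]

lemma height_cons_intCast (y : ℝ) (x : Fin m → ℤ) :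
    height (Fin.cons y (fun i => (x i : ℝ)) : Fin (m + 1) → ℝ) = ‖x‖ := by
  change ‖fun i => (x i : ℝ)‖ = ‖x‖
  simp only [Pi.norm_def, nnnorm, Int.norm_cast_real]

lemma abs_succ_le_height (a : Fin (m + 1) → ℝ) (i : Fin m) : |a i.succ| ≤ height a :=
  norm_le_pi_norm (fun i : Fin m => a i.succ) i

lemma cons_mem_integerVectors (y : ℤ) (x : Fin m → ℤ) :
    (Fin.cons (y : ℝ) fun i => (x i : ℝ)) ∈ integerVectors (Fin (m + 1)) :=
  ⟨Fin.cons y x, funext (Fin.cases rfl fun _ => rfl)⟩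

lemma exists_cons_eq_of_mem_integerVectors {a : Fin (m + 1) → ℝ}
    (ha : a ∈ integerVectors (Fin (m + 1))) :
    ∃ (y : ℤ) (x : Fin m → ℤ), a = Fin.cons (y : ℝ) fun i => (x i : ℝ) := by
  obtain ⟨b, rfl⟩ := ha
  exact ⟨b 0, Fin.tail b, funext (Fin.cases rfl fun _ => rfl)⟩

lemma finite_integerVectors_norm_le {n : Type*} [Fintype n] (R : ℝ) :
    {a ∈ (integerVectors n : Set (n → ℝ)) | ‖a‖ ≤ R}.Finite := by
  refine ((isCompact_closedBall (0 : n → ℤ) R).finite_of_discrete.image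
    fun b i => (b i : ℝ)).subset ?_
  rintro _ ⟨⟨b, rfl⟩, hb⟩
  refine ⟨b, mem_closedBall_zero_iff.2 (hb.trans' (le_of_eq ?_)), rfl⟩
  simp only [Pi.norm_def, nnnorm, AddMonoidHom.compLeft_apply, Function.comp_apply,
    Int.coe_castAddHom, Int.norm_cast_real]

lemma finite_integerVectors_height_le (θ : Fin m → ℝ) (M K : ℝ) :
    {a ∈ (integerVectors (Fin (m + 1)) : Set (Fin (m + 1) → ℝ)) |
      height a ≤ M ∧ |form θ a| ≤ K}.Finite := by
  refine (finite_integerVectors_norm_le (max (K + ∑ i, |θ i| * M) M)).subset ?_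
  rintro a ⟨ha, hM, hK⟩
  have hsucc (i : Fin m) : |a i.succ| ≤ M := (abs_succ_le_height a i).trans hM
  have hzero : |a 0| ≤ K + ∑ i, |θ i| * M :=
    calc |a 0| = |form θ a - ∑ i, θ i * a i.succ| := by rw [form_apply, add_sub_cancel_right]
      _ ≤ |form θ a| + ∑ i, |θ i * a i.succ| :=
          (abs_sub _ _).trans (add_le_add_right (Finset.abs_sum_le_sum_abs _ _) _)
      _ ≤ K + ∑ i, |θ i| * M := by
          simp only [abs_mul]
          gcongr with i
          exact hsucc i
  refine ⟨ha, (pi_norm_le_iff_of_nonempty _).2 (Fin.cases ?_ fun i => ?_)⟩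
  · exact hzero.trans (le_max_left _ _)
  · exact (hsucc i).trans (le_max_right _ _)

lemma exists_ne_abs_fract_sub_fract_lt {ι : Type*} [Fintype ι] (v : ι → ℝ) {M : ℕ} (hM : 0 < M)
    (hcard : M < Fintype.card ι) :
    ∃ i j, i ≠ j ∧ |Int.fract (v i) - Int.fract (v j)| < 1 / M := by
  have hM' : (0 : ℝ) < M := Nat.cast_pos.2 hM
  let box (i : ι) : ℕ := ⌊M * Int.fract (v i)⌋₊
  have hbox (i : ι) : (box i : ℤ) = ⌊M * Int.fract (v i)⌋ :=
    Int.natCast_floor_eq_floor (by positivity)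
  have hmaps : Set.MapsTo box (Finset.univ : Finset ι) (Finset.range M) := fun i _ => by
    rw [Finset.mem_coe, Finset.mem_range, Nat.floor_lt (by positivity)]
    exact mul_lt_of_lt_one_right hM' (Int.fract_lt_one _)
  obtain ⟨i, -, j, -, hij, hboxij⟩ :=
    Finset.exists_ne_map_eq_of_card_lt_of_maps_to (by simpa using hcard) hmaps
  refine ⟨i, j, hij, ?_⟩
  rw [lt_div_iff₀' hM', ← abs_of_pos hM', ← abs_mul, mul_sub]
  exact Int.abs_sub_lt_one_of_floor_eq_floor (by rw [← hbox, ← hbox, hboxij])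

lemma exists_height_le_abs_form_lt [NeZero m] (θ : Fin m → ℝ) {N : ℕ} (hN : 0 < N) :
    ∃ a ∈ integerVectors (Fin (m + 1)),
      0 < height a ∧ height a ≤ N ∧ |form θ a| < 1 / (N : ℝ) ^ m := by
  let v (x : Fin m → Fin (N + 1)) : ℝ := ∑ i, θ i * ((x i : ℕ) : ℝ)
  have hcard : N ^ m < Fintype.card (Fin m → Fin (N + 1)) := by
    simpa using Nat.pow_lt_pow_left N.lt_succ_self (NeZero.ne m)
  obtain ⟨x, y, hxy, hfract⟩ := exists_ne_abs_fract_sub_fract_lt v (by positivity) hcard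
  let w (i : Fin m) : ℤ := ((x i : ℕ) : ℤ) - ((y i : ℕ) : ℤ)
  refine ⟨_, cons_mem_integerVectors (-(⌊v x⌋ - ⌊v y⌋)) w, ?_, ?_, ?_⟩
  · rw [height_cons_intCast, norm_pos_iff]
    refine fun hw => hxy (funext fun i => Fin.ext ?_)
    exact_mod_cast sub_eq_zero.1 (congrFun hw i)
  · rw [height_cons_intCast, pi_norm_le_iff_of_nonneg (by positivity)]
    intro i
    have hw : |w i| ≤ N := by
      have := (x i).is_le
      have := (y i).is_le
      grind
    rw [Int.norm_eq_abs]
    exact_mod_cast hw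
  · have hform : form θ (Fin.cons ((-(⌊v x⌋ - ⌊v y⌋) : ℤ) : ℝ) fun i => (w i : ℝ)) =
        Int.fract (v x) - Int.fract (v y) := by
      simp only [form_cons, Int.fract, v, w]
      push_cast
      simp only [mul_sub, Finset.sum_sub_distrib]
      ring
    rw [hform]
    exact_mod_cast hfract

lemma abs_det_le_of_abs_form_le {A : Matrix (Fin (m + 1)) (Fin (m + 1)) ℝ}
    {X : Fin (m + 1) → ℝ} {c : ℝ} (hX : ∀ i, height (A i) ≤ X i)
    (hc : ∀ i, |form θ (A i)| ≤ c * X i) :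
    |A.det| ≤ (m + 1).factorial * (c * ∏ i, X i) := by
  have hdet : (A.updateCol 0 fun i => form θ (A i)).det = A.det := by
    simpa [form, Fintype.linearCombination_apply, mul_comm] using
      A.det_updateCol_sum 0 (Fin.cons 1 θ)
  have hle : ∀ i j, |A.updateCol 0 (fun i => form θ (A i)) i j| ≤
      X i * (Fin.cons c 1 : Fin (m + 1) → ℝ) j := by
    intro i
    refine Fin.cases ?_ fun j => ?_
    · simpa [mul_comm] using hc i
    · simpa using (abs_succ_le_height (A i) j).trans (hX i)
  calc |A.det| ≤ (Fintype.card (Fin (m + 1))).factorial *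
        ((∏ i, X i) * ∏ j, (Fin.cons c 1 : Fin (m + 1) → ℝ) j) :=
        hdet ▸ abs_det_le_of_abs_le_mul hle
    _ = (m + 1).factorial * (c * ∏ i, X i) := by
        simp [Fin.prod_univ_succ, mul_comm]

lemma exists_mem_integerVectors_notMem {n : Type*} [Finite n] {S : Submodule ℝ (n → ℝ)}
    (hS : S ≠ ⊤) : ∃ e ∈ integerVectors n, e ∉ S := by
  classical
  have := Fintype.ofFinite n
  by_contra! h
  refine hS (top_le_iff.1 ?_)
  rw [← (Pi.basisFun ℝ n).span_eq]
  refine Submodule.span_le.2 (Set.range_subset_iff.2 fun j => h _ ⟨Pi.single j 1, ?_⟩)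
  ext i
  simp [Pi.single_apply, apply_ite (Int.cast : ℤ → ℝ)]

end IntegerVectors

namespace IsBestApproxSeq

variable {θ : Fin 3 → ℝ} {Λ : AddSubgroup (Fin 4 → ℝ)} {z : ℕ → Fin 4 → ℝ} {i k : ℕ}

lemma abs_det_le (h : IsBestApproxSeq (form θ) height Λ z) {x : Fin 4 → ℝ} {X : ℝ}
    (hX : height x ≤ X) (hx : |form θ x| * height (z i) ≤ |form θ (z i)| * X) :
    |(Matrix.of ![x, z (i + 2), z i, z (i + 1)]).det| ≤
      24 * (|form θ (z i)| * height (z (i + 1)) * height (z (i + 2)) * X) := by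
  have hpos := h.size_pos i
  have hratio (w : Fin 4 → ℝ) (Y : ℝ) (hw : |form θ w| * height (z i) ≤ |form θ (z i)| * Y) :
      |form θ w| ≤ |form θ (z i)| / height (z i) * Y := by
    rwa [div_mul_eq_mul_div, le_div_iff₀ hpos]
  have hlater {l : ℕ} (hl : i ≤ l) :
      |form θ (z l)| * height (z i) ≤ |form θ (z i)| * height (z l) :=
    mul_le_mul (h.strictAnti_abs.antitone hl) (h.strictMono_size.monotone hl) hpos.le
      (abs_nonneg _)
  refine (abs_det_le_of_abs_form_le (θ := θ) (c := |form θ (z i)| / height (z i))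
    (X := ![X, height (z (i + 2)), height (z i), height (z (i + 1))]) ?_ ?_).trans_eq ?_
  · intro r
    fin_cases r
    exacts [hX, le_rfl, le_rfl, le_rfl]
  · intro r
    fin_cases r
    exacts [hratio _ _ hx, hratio _ _ (hlater (by omega)), hratio _ _ le_rfl,
      hratio _ _ (hlater (by omega))]
  · rw [Fin.prod_univ_four, show Nat.factorial (3 + 1) = 24 from rfl]
    push_cast
    field_simp

lemma one_le_of_linearIndependent
    (h : IsBestApproxSeq (form θ) height (integerVectors (Fin 4)) z) (hik : i < k)
    (hli : LinearIndependent ℝ ![z (k + 2), z (i + 2), z i, z (i + 1)]) :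
    1 ≤ 24 * (|form θ (z i)| * height (z (i + 1)) * height (z (i + 2)) * height (z (k + 2))) := by
  refine (one_le_abs_det (A := Matrix.of _) ?_ hli).trans (h.abs_det_le le_rfl ?_)
  · intro r
    fin_cases r <;> exact h.mem _
  · exact mul_le_mul (h.strictAnti_abs.antitone (by omega))
      (h.strictMono_size.monotone (by omega)) (h.size_pos i).le (abs_nonneg _)

/-- The idea is to replace the row `z (k + 2)` of a nonzero determinant by a fixed integer vector
outside `S`, moved by an element of `S` into the kernel of the form. -/
lemma exists_one_le_of_eventually_mem
    (h : IsBestApproxSeq (form θ) height (integerVectors (Fin 4)) z)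
    {S : Submodule ℝ (Fin 4 → ℝ)} (hS : S ≠ ⊤) (hmem : ∀ᶠ n in atTop, z n ∈ S) :
    ∃ H > 0, ∀ᶠ i in atTop, z (i + 2) ∉ plane z i →
      1 ≤ 24 * (|form θ (z i)| * height (z (i + 1)) * height (z (i + 2)) * H) := by
  obtain ⟨N, hN⟩ := eventually_atTop.1 hmem
  obtain ⟨e, heΛ, heS⟩ := exists_mem_integerVectors_notMem hS
  set w : Fin 4 → ℝ := e - (form θ e / form θ (z N)) • z N with hw
  have hformw : form θ w = 0 := by
    rw [hw, map_sub, map_smul, smul_eq_mul, div_mul_cancel₀ _ (_root_.abs_pos.1 (h.abs_pos N)),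
      sub_self]
  have hew : e - w ∈ S := by
    rw [hw, sub_sub_cancel]
    exact S.smul_mem _ (hN N le_rfl)
  have hH : 0 < height w + 1 := by positivity
  refine ⟨height w + 1, hH, ?_⟩
  filter_upwards [eventually_ge_atTop N] with i hi hplane
  have hrows (r : Fin 3) : ![z (i + 2), z i, z (i + 1)] r ∈ S := by
    fin_cases r
    exacts [hN _ (by omega), hN _ hi, hN _ (by omega)]
  have hli : LinearIndependent ℝ ![e, z (i + 2), z i, z (i + 1)] :=
    linearIndependent_finCons.2 ⟨h.linearIndependent_triple hplane, fun he =>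
      heS (Submodule.span_le.2 (Set.range_subset_iff.2 hrows) he)⟩
  calc 1 ≤ |(Matrix.of ![e, z (i + 2), z i, z (i + 1)]).det| := by
        refine one_le_abs_det (fun r => ?_) hli
        fin_cases r
        exacts [heΛ, h.mem _, h.mem _, h.mem _]
    _ = |(Matrix.of ![w, z (i + 2), z i, z (i + 1)]).det| :=
        congrArg _ (det_cons_eq_of_sub_mem hS hrows hew)
    _ ≤ 24 * (|form θ (z i)| * height (z (i + 1)) * height (z (i + 2)) * (height w + 1)) := by
        refine h.abs_det_le (le_add_of_nonneg_right zero_le_one) ?_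
        rw [hformw, abs_zero, zero_mul]
        positivity

end IsBestApproxSeq

section Growth

lemma nonpos_of_frequently_mul_le {ι : Type*} {l : Filter ι} {u : ι → ℝ} {F K : ℝ}
    (hu : Tendsto u l atTop) (h : ∃ᶠ x in l, F * u x ≤ K) : F ≤ 0 := by
  by_contra! hF
  obtain ⟨x, hx, hKx⟩ :=
    (h.and_eventually ((hu.const_mul_atTop hF).eventually_gt_atTop K)).exists
  exact hx.not_gt hKx

lemma nonneg_log_add_of_one_le_mul {K x₁ x₂ x₃ x₄ : ℝ} (hK : 0 < K) (h₁ : 0 < x₁) (h₂ : 0 < x₂)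
    (h₃ : 0 < x₃) (h₄ : 0 < x₄) (h : 1 ≤ K * (x₁ * x₂ * x₃ * x₄)) :
    0 ≤ Real.log K + (Real.log x₁ + Real.log x₂ + Real.log x₃ + Real.log x₄) := by
  rw [← Real.log_mul, ← Real.log_mul, ← Real.log_mul, ← Real.log_mul]
  · exact Real.log_nonneg h
  all_goals positivity

/-- Here `u`, `v`, `w`, `x` are the logarithms of the heights of `z (i + 1)`, `z (i + 2)`,
`z (k + 1)`, `z (k + 2)`; `hu` comes from the determinant, `hw` from comparing covolumes. -/
lemma mul_le_of_growth_bounds {γ b C u v w x : ℝ} (hγ : 1 < γ) (hb : 0 ≤ b)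
    (hbγ : b ≤ γ * (γ - 1)) (hu : (γ - 1) * u ≤ C + v + x)
    (hw : (γ - 1) * w ≤ C + b * u - v) (hv : γ * v ≤ C + b * u) (hx : γ * x ≤ C + b * w) :
    (γ ^ 2 * (γ - 1) - (γ * b + b ^ 2)) * u ≤ (γ ^ 2 + 2 * γ + b) * C := by
  have hγ₁ : 0 < γ - 1 := sub_pos.2 hγ
  refine le_of_mul_le_mul_left ?_ hγ₁
  linear_combination γ ^ 2 * (γ - 1) * hu + γ * b * hw + (γ * (γ - 1) - b) * hv +
    γ * (γ - 1) * hx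

end Growth

namespace IsBestApproxSeq

lemma tendsto_abs_mul_size {E : Type*} [AddCommGroup E] [Module ℝ E] {L : E →ₗ[ℝ] ℝ}
    {p : Seminorm ℝ E} {Λ : AddSubgroup E} {z : ℕ → E} (h : IsBestApproxSeq L p Λ z)
    (hsize : Tendsto (fun n => p (z n)) atTop atTop) {γ c : ℝ} (hγ : 1 < γ)
    (hL : ∀ᶠ n in atTop, Real.log |L (z n)| ≤ c - γ * Real.log (p (z (n + 1)))) :
    Tendsto (fun n => |L (z n)| * p (z (n + 1))) atTop (nhds 0) := by
  have hlog : Tendsto (fun n => Real.log (p (z (n + 1)))) atTop atTop :=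
    Real.tendsto_log_atTop.comp (hsize.comp (tendsto_add_atTop_nat 1))
  have hbot : Tendsto (fun n => c - (γ - 1) * Real.log (p (z (n + 1)))) atTop atBot :=
    tendsto_atBot_add_const_left _ c
      (tendsto_neg_atTop_atBot.comp (hlog.const_mul_atTop (sub_pos.2 hγ)))
  have hlogprod : Tendsto (fun n => Real.log (|L (z n)| * p (z (n + 1)))) atTop atBot := by
    refine tendsto_atBot_mono' atTop ?_ hbot
    filter_upwards [hL] with n hn
    rw [Real.log_mul (h.abs_pos n).ne' (h.size_pos _).ne']
    linarith
  exact (Real.tendsto_exp_atBot.comp hlogprod).congr fun n => Real.exp_log (h.abs_mul_size_pos n)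

variable {θ : Fin 3 → ℝ} {z : ℕ → Fin 4 → ℝ} {γ b c : ℝ}

lemma mul_sub_one_le_of_eventually_mem
    (h : IsBestApproxSeq (form θ) height (integerVectors (Fin 4)) z)
    {S : Submodule ℝ (Fin 4 → ℝ)} (hS : S ≠ ⊤) (hmem : ∀ᶠ n in atTop, z n ∈ S) (hγ : 1 < γ)
    (hle : ∀ᶠ n in atTop, Real.log |form θ (z n)| ≤ c - γ * Real.log (height (z (n + 1))))
    (hge : ∀ᶠ n in atTop, -(b * Real.log (height (z n))) ≤ Real.log |form θ (z n)|) :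
    γ * (γ - 1) ≤ b := by
  have hsize := h.tendsto_size (finite_integerVectors_height_le θ)
  have hlog : Tendsto (fun n => Real.log (height (z (n + 1)))) atTop atTop :=
    Real.tendsto_log_atTop.comp (hsize.comp (tendsto_add_atTop_nat 1))
  have hfreq := h.frequently_notMem_plane (h.tendsto_abs_mul_size hsize hγ hle)
  obtain ⟨H, hH, hbound⟩ := h.exists_one_le_of_eventually_mem hS hmem
  refine sub_nonpos.1 (nonpos_of_frequently_mul_le (F := γ * (γ - 1) - b)
    (K := γ * (Real.log 24 + c + Real.log H) + c) hlog ?_)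
  have hev := hbound.and (hle.and ((tendsto_add_atTop_nat 1).eventually (hle.and hge)))
  refine (hfreq.and_eventually hev).mono ?_
  rintro i ⟨hplane, hi, hlei, hle', hge'⟩
  have hprod := nonneg_log_add_of_one_le_mul (by norm_num) (h.abs_pos i) (h.size_pos (i + 1))
    (h.size_pos (i + 2)) hH (hi hplane)
  linear_combination γ * (hprod + hlei) + hle' + hge'

lemma sq_mul_sub_one_le_of_frequently_notMem
    (h : IsBestApproxSeq (form θ) height (integerVectors (Fin 4)) z)
    (hspan : ∀ S : Submodule ℝ (Fin 4 → ℝ), S ≠ ⊤ → ∃ᶠ n in atTop, z n ∉ S)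
    (hγ : 1 < γ) (hb : 0 ≤ b) (hbγ : b ≤ γ * (γ - 1))
    (hle : ∀ᶠ n in atTop, Real.log |form θ (z n)| ≤ c - γ * Real.log (height (z (n + 1))))
    (hge : ∀ᶠ n in atTop, -(b * Real.log (height (z n))) ≤ Real.log |form θ (z n)|) :
    γ ^ 2 * (γ - 1) ≤ γ * b + b ^ 2 := by
  have hsize := h.tendsto_size (finite_integerVectors_height_le θ)
  have hlog : Tendsto (fun n => Real.log (height (z (n + 1)))) atTop atTop :=
    Real.tendsto_log_atTop.comp (hsize.comp (tendsto_add_atTop_nat 1))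
  have hfreq := h.frequently_linearIndependent_quadruple (by simp)
    (h.tendsto_abs_mul_size hsize hγ hle) hspan
  refine sub_nonpos.1 (nonpos_of_frequently_mul_le
    (K := (γ ^ 2 + 2 * γ + b) * (c + Real.log 24)) hlog ?_)
  refine (hfreq.and_eventually (eventually_forall_ge_atTop.2 (hle.and hge))).mono ?_
  rintro i ⟨⟨k, hik, hplane, hli⟩, hi⟩
  have hL (n : ℕ) : |form θ (z n)| ≠ 0 := (h.abs_pos n).ne'
  have hX (n : ℕ) : height (z n) ≠ 0 := (h.size_pos n).ne'
  have hprod := nonneg_log_add_of_one_le_mul (by norm_num) (h.abs_pos i) (h.size_pos (i + 1))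
    (h.size_pos (i + 2)) (h.size_pos (k + 2)) (h.one_le_of_linearIndependent hik hli)
  have hcovol := Real.log_le_log (h.abs_mul_size_pos (i + 1)) (h.abs_mul_size_le_of_mem_plane
    (hplane ▸ mem_plane_left z k) (hplane ▸ mem_plane_right z k))
  rw [Real.log_mul (hL _) (hX _), Real.log_mul (by norm_num) (mul_ne_zero (hL _) (hX _)),
    Real.log_mul (hL _) (hX _)] at hcovol
  have hlog4 : Real.log 4 ≤ Real.log 24 := Real.log_le_log (by norm_num) (by norm_num)
  have hlog24 : 0 ≤ Real.log 24 := Real.log_nonneg (by norm_num)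
  obtain ⟨hle₀, -⟩ := hi i le_rfl
  obtain ⟨hle₁, hge₁⟩ := hi (i + 1) (by omega)
  obtain ⟨hlek, -⟩ := hi k hik.le
  obtain ⟨hlek₁, hgek₁⟩ := hi (k + 1) (by omega)
  apply mul_le_of_growth_bounds (v := Real.log (height (z (i + 2))))
    (w := Real.log (height (z (k + 1)))) (x := Real.log (height (z (k + 2)))) hγ hb hbγ <;> linarith

lemma exponent_inequality (h : IsBestApproxSeq (form θ) height (integerVectors (Fin 4)) z)
    (hγ : 1 < γ) (hb : 0 ≤ b)
    (hle : ∀ᶠ n in atTop, Real.log |form θ (z n)| ≤ c - γ * Real.log (height (z (n + 1))))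
    (hge : ∀ᶠ n in atTop, -(b * Real.log (height (z n))) ≤ Real.log |form θ (z n)|) :
    γ ^ 2 * (γ - 1) ≤ γ * b + b ^ 2 := by
  have hlarge (hbγ : γ * (γ - 1) ≤ b) : γ ^ 2 * (γ - 1) ≤ γ * b + b ^ 2 := by
    nlinarith
  by_cases hspan : ∀ S : Submodule ℝ (Fin 4 → ℝ), S ≠ ⊤ → ∃ᶠ n in atTop, z n ∉ S
  · rcases le_total b (γ * (γ - 1)) with hbγ | hbγ
    · exact h.sq_mul_sub_one_le_of_frequently_notMem hspan hγ hb hbγ hle hge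
    · exact hlarge hbγ
  · push Not at hspan
    obtain ⟨S, hS, hmem⟩ := hspan
    exact hlarge (h.mul_sub_one_le_of_eventually_mem hS hmem hγ hle hge)

end IsBestApproxSeq

section Exponents

variable {m : ℕ} {Θ : Matrix (Fin 1) (Fin m) ℝ}

lemma zeta_eq_distInt (Θ : Matrix (Fin 1) (Fin m) ℝ) (x : Fin m → ℤ) :
    zeta Θ x = distInt (linForm Θ 0 x) :=
  ciSup_unique

lemma zeta_nonneg (Θ : Matrix (Fin 1) (Fin m) ℝ) (x : Fin m → ℤ) : 0 ≤ zeta Θ x :=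
  zeta_eq_distInt Θ x ▸ abs_nonneg _

lemma psi_nonneg (Θ : Matrix (Fin 1) (Fin m) ℝ) (t : ℝ) : 0 ≤ psi Θ t :=
  Real.sInf_nonneg (Set.forall_mem_image.2 fun x _ => zeta_nonneg Θ x)

lemma form_cons_intCast (Θ : Matrix (Fin 1) (Fin m) ℝ) (y : ℝ) (x : Fin m → ℤ) :
    form (Θ 0) (Fin.cons y fun i => (x i : ℝ)) = linForm Θ 0 x + y := by
  rw [form_cons, linForm, add_comm]

lemma psi_le {a : Fin (m + 1) → ℝ} {t : ℝ} (ha : a ∈ integerVectors (Fin (m + 1)))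
    (hpos : 0 < height a) (hle : height a ≤ t) : psi Θ t ≤ |form (Θ 0) a| := by
  obtain ⟨y, x, rfl⟩ := exists_cons_eq_of_mem_integerVectors ha
  rw [height_cons_intCast] at hpos hle
  calc psi Θ t ≤ zeta Θ x :=
        csInf_le ⟨0, Set.forall_mem_image.2 fun x _ => zeta_nonneg Θ x⟩ ⟨x, ⟨hpos, hle⟩, rfl⟩
    _ ≤ |linForm Θ 0 x - (-y : ℤ)| := by
        rw [zeta_eq_distInt, distInt]
        exact round_le _ _
    _ = |form (Θ 0) (Fin.cons (y : ℝ) fun i => (x i : ℝ))| := by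
        rw [form_cons_intCast, Int.cast_neg, sub_neg_eq_add]

lemma le_psi [NeZero m] {K t : ℝ} (ht : 1 ≤ t)
    (h : ∀ a ∈ integerVectors (Fin (m + 1)), 0 < height a → height a ≤ t → K ≤ |form (Θ 0) a|) :
    K ≤ psi Θ t := by
  refine le_csInf ⟨_, fun _ => 1, ⟨?_, ?_⟩, rfl⟩ (Set.forall_mem_image.2 ?_)
  · simp [pi_norm_const]
  · simpa [pi_norm_const] using ht
  · rintro x ⟨hpos, hle⟩
    rw [← height_cons_intCast] at hpos hle
    have hx := h _ (cons_mem_integerVectors (-round (linForm Θ 0 x)) x) hpos hle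
    rwa [form_cons_intCast, Int.cast_neg, ← sub_eq_add_neg, ← distInt, ← zeta_eq_distInt] at hx

lemma form_ne_zero_of_eventually_psi_pos (hpsi : ∀ᶠ t in atTop, 0 < psi Θ t)
    {a : Fin (m + 1) → ℝ} (ha : a ∈ integerVectors (Fin (m + 1))) (ha0 : a ≠ 0) :
    form (Θ 0) a ≠ 0 := by
  rcases (apply_nonneg (height (m := m)) a).eq_or_lt with h0 | hpos
  · obtain ⟨y, x, rfl⟩ := exists_cons_eq_of_mem_integerVectors ha
    obtain rfl : x = 0 := by rwa [height_cons_intCast, eq_comm, norm_eq_zero] at h0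
    have hy : (y : ℝ) ≠ 0 := fun hy => ha0 (funext (Fin.cases hy fun _ => Int.cast_zero))
    simpa [form_cons] using hy
  · obtain ⟨t, ht, hat⟩ := (hpsi.and (eventually_ge_atTop (height a))).exists
    exact abs_pos.1 (ht.trans_le (psi_le ha hpos hat))

lemma exists_isBestApproxSeq_form [NeZero m] (hpsi : ∀ᶠ t in atTop, 0 < psi Θ t) :
    ∃ z, IsBestApproxSeq (form (Θ 0)) height (integerVectors (Fin (m + 1))) z := by
  refine exists_isBestApproxSeq (finite_integerVectors_height_le _) (fun K hK => ?_)
    fun a ha ha0 => form_ne_zero_of_eventually_psi_pos hpsi ha ha0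
  obtain ⟨n, hn⟩ := exists_nat_one_div_lt hK
  obtain ⟨a, ha, hpos, -, hform⟩ := exists_height_le_abs_form_lt (Θ 0) n.succ_pos
  refine ⟨a, ha, fun h0 => hpos.ne' (by rw [h0, map_zero]), hform.trans (hn.trans_le' ?_)⟩
  push_cast
  exact one_div_le_one_div_of_le (by positivity)
    (le_self_pow₀ (le_add_of_nonneg_left n.cast_nonneg) (NeZero.ne m))

namespace IsBestApproxSeq

variable {z : ℕ → Fin (m + 1) → ℝ} {γ b C : ℝ}

/-- Evaluating `psi` at any `t < height (z (n + 1))`, for example at half that height, already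
detects `z n`. -/
lemma eventually_log_abs_le [NeZero m]
    (h : IsBestApproxSeq (form (Θ 0)) height (integerVectors (Fin (m + 1))) z)
    (hpsi : ∀ᶠ t in atTop, t ^ γ * psi Θ t ≤ C) :
    ∃ c, ∀ᶠ n in atTop,
      Real.log |form (Θ 0) (z n)| ≤ c - γ * Real.log (height (z (n + 1))) := by
  have hhalf : Tendsto (fun n => height (z (n + 1)) / 2) atTop atTop :=
    ((h.tendsto_size (finite_integerVectors_height_le _)).comp
      (tendsto_add_atTop_nat 1)).atTop_div_const two_pos
  refine ⟨Real.log C + γ * Real.log 2, ?_⟩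
  filter_upwards [hhalf.eventually hpsi, hhalf.eventually_ge_atTop 1] with n hn hn1
  have hX := h.size_pos (n + 1)
  have hpow : 0 < (height (z (n + 1)) / 2) ^ γ := Real.rpow_pos_of_pos (half_pos hX) _
  have hform : |form (Θ 0) (z n)| ≤ psi Θ (height (z (n + 1)) / 2) := by
    refine le_psi hn1 fun a ha hpos hle => ?_
    exact h.abs_le n a ha (fun h0 => hpos.ne' (by rw [h0, map_zero]))
      (hle.trans_lt (half_lt_self hX))
  have hlog := Real.log_le_log (mul_pos hpow (h.abs_pos n))
    ((mul_le_mul_of_nonneg_left hform hpow.le).trans hn)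
  rw [Real.log_mul hpow.ne' (h.abs_pos n).ne', Real.log_rpow (half_pos hX),
    Real.log_div hX.ne' two_ne_zero] at hlog
  linarith

lemma eventually_neg_mul_log_le
    (h : IsBestApproxSeq (form (Θ 0)) height (integerVectors (Fin (m + 1))) z)
    (hpsi : ∀ᶠ t in atTop, 1 ≤ t ^ b * psi Θ t) :
    ∀ᶠ n in atTop, -(b * Real.log (height (z n))) ≤ Real.log |form (Θ 0) (z n)| := by
  filter_upwards [(h.tendsto_size (finite_integerVectors_height_le _)).eventually hpsi] with n hn
  have hX := h.size_pos n
  have hpow : 0 < height (z n) ^ b := Real.rpow_pos_of_pos hX _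
  have hlog := Real.log_nonneg
    (hn.trans (mul_le_mul_of_nonneg_left (psi_le (h.mem n) hX le_rfl) hpow.le))
  rw [Real.log_mul hpow.ne' (h.abs_pos n).ne', Real.log_rpow hX] at hlog
  linarith

end IsBestApproxSeq

lemma exists_eventually_rpow_mul_psi_le {γ : ℝ} (h : (γ : EReal) < uniformExponent Θ) :
    ∃ C : ℝ, ∀ᶠ t in atTop, t ^ γ * psi Θ t ≤ C := by
  obtain ⟨_, ⟨δ, -, rfl, hδ⟩, hγδ⟩ := lt_sSup_iff.1 h
  obtain ⟨C, hC, -⟩ := EReal.lt_iff_exists_real_btwn.1 hδ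
  refine ⟨C, ?_⟩
  filter_upwards [eventually_lt_of_limsup_lt hC, eventually_ge_atTop 1] with t htC ht
  calc t ^ γ * psi Θ t ≤ t ^ δ * psi Θ t :=
        mul_le_mul_of_nonneg_right
          (Real.rpow_le_rpow_of_exponent_le ht (EReal.coe_lt_coe_iff.1 hγδ).le) (psi_nonneg Θ t)
    _ ≤ C := (EReal.coe_lt_coe_iff.1 htC).le

lemma eventually_one_le_rpow_mul_psi {b : ℝ} (hb : 0 < b) (h : individualExponent Θ < b) :
    ∀ᶠ t in atTop, 1 ≤ t ^ b * psi Θ t := by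
  have htop : liminf (fun t : ℝ => ((t ^ b * psi Θ t : ℝ) : EReal)) atTop = ⊤ := by
    by_contra hne
    exact h.not_ge (le_sSup ⟨b, hb, rfl, lt_top_iff_ne_top.2 hne⟩)
  filter_upwards [eventually_lt_of_lt_liminf (htop ▸ EReal.coe_lt_top 1)] with t ht
  exact (EReal.coe_lt_coe_iff.1 ht).le

lemma natCast_le_uniformExponent [NeZero m] (Θ : Matrix (Fin 1) (Fin m) ℝ) :
    (m : EReal) ≤ uniformExponent Θ := by
  refine le_sSup ⟨m, Nat.cast_pos.2 (NeZero.pos m), EReal.coe_natCast.symm, ?_⟩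
  refine (limsup_le_of_le (a := ((2 ^ m : ℝ) : EReal)) (h := ?_)).trans_lt (EReal.coe_lt_top _)
  filter_upwards [eventually_ge_atTop 1] with t ht
  have hN : 0 < ⌊t⌋₊ := Nat.floor_pos.2 ht
  have hN1 : (1 : ℝ) ≤ ⌊t⌋₊ := Nat.one_le_cast.2 hN
  obtain ⟨a, ha, hpos, hle, hform⟩ := exists_height_le_abs_form_lt (Θ 0) hN
  have ht2 : t ≤ 2 * ⌊t⌋₊ := by linarith [Nat.lt_floor_add_one t]
  refine EReal.coe_le_coe_iff.2 ?_
  calc t ^ (m : ℝ) * psi Θ t ≤ (2 * ⌊t⌋₊ : ℝ) ^ m * (1 / (⌊t⌋₊ : ℝ) ^ m) := by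
        rw [Real.rpow_natCast]
        exact mul_le_mul (pow_le_pow_left₀ (by linarith) ht2 m)
          ((psi_le ha hpos (hle.trans (Nat.floor_le (by linarith)))).trans hform.le)
          (psi_nonneg Θ t) (by positivity)
    _ = 2 ^ m := by
        rw [mul_pow]
        field_simp

end Exponents

section RegularRatio

/-- The positive root of `g ^ 2 + g = a - 1`: the sharper lower bound for the ratio of the
individual to the uniform exponent that the argument gives in place of `g2`. -/
noncomputable def regularRatio (a : ℝ) : ℝ := √(a - 3 / 4) - 1 / 2

lemma regularRatio_sq_add_self {a : ℝ} (ha : 3 / 4 ≤ a) :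
    regularRatio a ^ 2 + regularRatio a = a - 1 := by
  rw [regularRatio]
  linear_combination Real.sq_sqrt (sub_nonneg.2 ha)

lemma regularRatio_pos {a : ℝ} (ha : 1 < a) : 0 < regularRatio a :=
  sub_pos.2 (Real.lt_sqrt_of_sq_lt (by linarith))

lemma one_le_regularRatio {a : ℝ} (ha : 3 ≤ a) : 1 ≤ regularRatio a :=
  le_sub_iff_add_le.2 (Real.le_sqrt_of_sq_le (by linarith))

lemma mul_g2_le_mul_regularRatio {a : ℝ} (ha : 3 ≤ a) : a * g2 a ≤ a * regularRatio a := by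
  have ha0 : 0 < a := by linarith
  have hsq : √(a - 3 / 4) ^ 2 = a - 3 / 4 := Real.sq_sqrt (by linarith)
  have hinv : 1 / a ≤ √(a - 3 / 4) :=
    (one_div_le_one_div_of_le one_pos (by linarith)).trans
      (Real.le_sqrt_of_sq_le (by linarith))
  have hmul : 2 * √(a - 3 / 4) ≤ a := by
    rw [← le_div_iff₀' two_pos]
    exact Real.sqrt_le_iff.2 ⟨by linarith, by nlinarith⟩
  have hdiv : 2 * √(a - 3 / 4) * (1 / a) ≤ 1 := by
    rwa [mul_one_div, div_le_one ha0]
  have hsqrt : √(a + 1 / a ^ 2 - 7 / 4) ≤ √(a - 3 / 4) - 1 / a := by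
    refine Real.sqrt_le_iff.2 ⟨sub_nonneg.2 hinv, ?_⟩
    rw [← one_div_pow]
    linear_combination hdiv - hsq
  refine mul_le_mul_of_nonneg_left ?_ ha0.le
  rw [g2, regularRatio]
  linarith

lemma rpow_three_halves_sub_lt_mul_g2 {a : ℝ} (ha : 3 ≤ a) :
    a ^ (3 / 2 : ℝ) - 3 * a < a * g2 a := by
  have ha0 : 0 < a := by linarith
  have hrpow : a ^ (3 / 2 : ℝ) = a * √a := by
    rw [Real.sqrt_eq_rpow, ← Real.rpow_one_add' ha0.le (by norm_num)]
    norm_num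
  have hsqrt : √a - 5 / 2 ≤ √(a + 1 / a ^ 2 - 7 / 4) := by
    have hlow : 8 / 5 ≤ √a := Real.le_sqrt_of_sq_le (by linarith)
    have hinv : 0 < 1 / a ^ 2 := by positivity
    exact Real.le_sqrt_of_sq_le (by linarith [Real.sq_sqrt ha0.le])
  have hg2 : √a - 3 < g2 a := by
    have hinv : 0 < 1 / a := by positivity
    rw [g2]
    linarith
  rw [hrpow]
  linarith [mul_lt_mul_of_pos_left hg2 ha0]

end RegularRatio

section ThreeVariables

variable {Θ : Matrix (Fin 1) (Fin 3) ℝ}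

lemma sq_mul_sub_one_le_of_lt_of_lt {γ b : ℝ} (hγ : 1 < γ) (hb : 0 < b)
    (hγΘ : γ < uniformExponent Θ) (hbΘ : individualExponent Θ < b) :
    γ ^ 2 * (γ - 1) ≤ γ * b + b ^ 2 := by
  obtain ⟨C, hC⟩ := exists_eventually_rpow_mul_psi_le hγΘ
  have hone := eventually_one_le_rpow_mul_psi hb hbΘ
  have hpos : ∀ᶠ t in atTop, 0 < psi Θ t := by
    filter_upwards [hone, eventually_gt_atTop 0] with t ht ht0
    exact pos_of_mul_pos_right (one_pos.trans_le ht) (Real.rpow_nonneg ht0.le b)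
  obtain ⟨z, hz⟩ := exists_isBestApproxSeq_form hpos
  obtain ⟨c, hc⟩ := hz.eventually_log_abs_le hC
  exact hz.exponent_inequality hγ hb.le hc (hz.eventually_neg_mul_log_le hone)

lemma mul_regularRatio_le_of_lt {γ : ℝ} (hγ : 1 < γ) (hγΘ : γ < uniformExponent Θ) :
    ((γ * regularRatio γ : ℝ) : EReal) ≤ individualExponent Θ := by
  by_contra! hlt
  have hpos : 0 < γ * regularRatio γ := mul_pos (one_pos.trans hγ) (regularRatio_pos hγ)
  obtain ⟨b, hb, hbγ⟩ := EReal.lt_iff_exists_real_btwn.1 (max_lt hlt (EReal.coe_pos.2 hpos))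
  have hb0 : 0 < b := EReal.coe_pos.1 ((le_max_right _ _).trans_lt hb)
  have hle := sq_mul_sub_one_le_of_lt_of_lt hγ hb0 hγΘ ((le_max_left _ _).trans_lt hb)
  have hsq : γ ^ 2 * (γ - 1) = γ * (γ * regularRatio γ) + (γ * regularRatio γ) ^ 2 := by
    rw [← regularRatio_sq_add_self (by linarith)]
    ring
  have hbγ' : b < γ * regularRatio γ := EReal.coe_lt_coe_iff.1 hbγ
  refine hle.not_gt (hsq ▸ ?_)
  gcongr

lemma mul_regularRatio_le_of_eq {a : ℝ} (ha : 1 < a) (haΘ : uniformExponent Θ = a) :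
    ((a * regularRatio a : ℝ) : EReal) ≤ individualExponent Θ := by
  have hcont : Continuous fun γ : ℝ => ((γ * regularRatio γ : ℝ) : EReal) := by
    unfold regularRatio
    exact continuous_coe_real_ereal.comp (by fun_prop)
  refine le_of_tendsto (hcont.continuousWithinAt (s := Set.Iio a)) ?_
  filter_upwards [Ioo_mem_nhdsLT ha] with γ hγ
  exact mul_regularRatio_le_of_lt hγ.1 (haΘ ▸ EReal.coe_lt_coe_iff.2 hγ.2)

lemma individualExponent_eq_top (h : uniformExponent Θ = ⊤) : individualExponent Θ = ⊤ := by
  refine EReal.eq_top_iff_forall_lt _ |>.2 fun y => ?_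
  set γ : ℝ := max y 2 + 1
  have hyγ : y < γ := (le_max_left y 2).trans_lt (lt_add_one _)
  have hγ3 : 3 ≤ γ := by linarith [le_max_right y 2]
  calc (y : EReal) < ((γ * regularRatio γ : ℝ) : EReal) :=
        EReal.coe_lt_coe_iff.2 (hyγ.trans_le
          (le_mul_of_one_le_right (by linarith) (one_le_regularRatio hγ3)))
    _ ≤ individualExponent Θ :=
        mul_regularRatio_le_of_lt (by linarith) (h ▸ EReal.coe_lt_top γ)

end ThreeVariables

end Diophantine

open Diophantine in
theorem theorem3_general (Θ : Matrix (Fin 1) (Fin 3) ℝ) :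
    3 ≤ uniformExponent Θ ∧
    (∀ a : ℝ, uniformExponent Θ = a →
      ((a * regularRatio a : ℝ) : EReal) ≤ individualExponent Θ) ∧
    (uniformExponent Θ = ⊤ → individualExponent Θ = ⊤) := by
  have hthree : (3 : EReal) ≤ uniformExponent Θ := mod_cast natCast_le_uniformExponent Θ
  refine ⟨hthree, fun a ha => mul_regularRatio_le_of_eq ?_ ha, individualExponent_eq_top⟩
  have ha3 : (3 : ℝ) ≤ a := EReal.coe_le_coe_iff.1 (ha ▸ hthree)
  linarith

theorem theorem3 :
    (∀ θ₁ θ₂ θ₃ : ℝ, LinearIndependent ℤ ![1, θ₁, θ₂, θ₃] →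
      (3 : EReal) ≤ Diophantine.uniformExponent !![θ₁, θ₂, θ₃] ∧
      (∀ a : ℝ, Diophantine.uniformExponent !![θ₁, θ₂, θ₃] = (a : EReal) →
        ((a * Diophantine.g2 a : ℝ) : EReal) ≤ Diophantine.individualExponent !![θ₁, θ₂, θ₃]) ∧
      (Diophantine.uniformExponent !![θ₁, θ₂, θ₃] = ⊤ →
        Diophantine.individualExponent !![θ₁, θ₂, θ₃] = ⊤)) ∧
    (∀ a : ℝ, 3 ≤ a → a ^ (3 / 2 : ℝ) - 3 * a < a * Diophantine.g2 a) := by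
  refine ⟨fun θ₁ θ₂ θ₃ _ => ?_, fun _ => Diophantine.rpow_three_halves_sub_lt_mul_g2⟩
  obtain ⟨hthree, hreal, htop⟩ := theorem3_general !![θ₁, θ₂, θ₃]
  exact ⟨hthree, fun a ha => (EReal.coe_le_coe_iff.2 (Diophantine.mul_g2_le_mul_regularRatio
    (EReal.coe_le_coe_iff.1 (ha ▸ hthree)))).trans (hreal a ha), htop⟩
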